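/- Let $D\ge 0$, $M\ge 2$, $N\ge 1$ be integers. Let $\rho:\mathbb{R}\to[0,\infty)$ be $L_\rho$-Lipschitz (in particular, $\rho$ may be a positive $L_\rho$-Lipschitz activation), let $C_1,C_2,C_3,C_4,d_{\min}$ be real constants, and let the input space $\mathcal X\subseteq\mathbb{R}^D$ satisfy $\|x\|_2\le C_1$ for all $x\in\mathcal X$. Let $\mathcal Q$ be a Borel probability measure on $\mathbb{R}^D\times\mathbb{R}$ such that $x\in\mathcal X$ and $|y|\le C_2$ for $\mathcal Q$-almost every $(x,y)$. Let $\mathcal F$ be the class of all one-hidden-layer networks $f(x)=\sum_{m=1}^M v_m\phi_m(x)$, $\phi_m(x)=\rho(w_m^{T}x)$, with $w_m\in\mathbb{R}^D$, $\|w_m\|_2\le C_3$ for all $m$, $v\in\mathbb{R}^M$, $\|v\|_\infty\le C_4$, and $$\frac{1}{2M(M-1)}\sum_{n\ne m}\bigl(\phi_n(x)-\phi_m(x)\bigr)^2\ \ge\ d_{\min}^2\qquad\text{for every }x\in\mathcal X,$$ where the sum is over ordered pairs $(n,m)\in\{1,\dots,M\}^2$ with $n\neq m$. For $f\in\mathcal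 F$ let $L(f)=\mathbb{E}_{(x,y)\sim\mathcal Q}\bigl[\tfrac12|f(x)-y|^2\bigr]$ and, for an i.i.d. sample $(x_1,y_1),\dots,(x_N,y_N)$ from $\mathcal Q$, let $\hat L(f)=\frac1N\sum_{i=1}^N\tfrac12|f(x_i)-y_i|^2$. Let $f^*\in\operatorname{argmin}_{f\in\mathcal F}L(f)$. Put $$C_5=L_\rho C_1C_3+\rho(0),\qquad \mathcal J=C_4^2\bigl(MC_5^2+M(M-1)(C_5^2-d_{\min}^2)\bigr),\qquad A=4\bigl(2L_\rho C_1C_3C_4+C_4|\rho(0)|\bigr)M .$$ Then for every $\delta\in(0,1)$, with probability at least $1-\delta$ over the sample, every empirical risk minimizer $\hat f\in\operatorname{argmin}_{f\in\mathcal F}\hat L(f)$ satisfies $$L(\hat f)-L(f^*)\ \le\ \bigl(\sqrt{\mathcal J}+C_2\bigr)\frac{A}{\sqrt N}+\frac12\bigl(\sqrt{\mathcal J}+C_2\bigr)^2\sqrt{\frac{2\log(2/\delta)}{N}} .$$ Moreover, with the other constants fixed, $\mathcal J$ is a nonincreasing function of $d_{\min}\in[0,\infty)$, and strictly decreasing if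 $C_4\neq0$. -/

import Mathlib

open scoped NNReal

noncomputable section

namespace DiverseNet

/-- The `m`-th hidden feature `φ_m(x) = ρ(w_mᵀ x)`. -/
def feature {D M : ℕ} (ρ : ℝ → ℝ) (W : Fin M → EuclideanSpace ℝ (Fin D)) (m : Fin M)
    (x : EuclideanSpace ℝ (Fin D)) : ℝ :=
  ρ (inner ℝ (W m) x)

/-- The one-hidden-layer network `f(x) = ∑ m, v_m ρ(w_mᵀ x)`. -/
def network {D M : ℕ} (ρ : ℝ → ℝ) (W : Fin M → EuclideanSpace ℝ (Fin D)) (v : Fin M → ℝ)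
    (x : EuclideanSpace ℝ (Fin D)) : ℝ :=
  ∑ m, v m * feature ρ W m x

/-- The feature diversity at `x`:
`1 / (2 M (M - 1)) * ∑_{n ≠ m} (φ_n(x) - φ_m(x))²`, the sum being over ordered pairs. -/
def diversity {D M : ℕ} (ρ : ℝ → ℝ) (W : Fin M → EuclideanSpace ℝ (Fin D))
    (x : EuclideanSpace ℝ (Fin D)) : ℝ :=
  1 / (2 * (M : ℝ) * ((M : ℝ) - 1)) *
    ∑ p ∈ (Finset.univ : Finset (Fin M)).offDiag,
      (feature ρ W p.1 x - feature ρ W p.2 x) ^ 2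

/-- The hypothesis class: networks with hidden weights of Euclidean norm at most `C₃`, output
weights of sup norm at most `C₄` (`‖v‖` is the sup norm on `Fin M → ℝ`), and diversity at least
`dmin ^ 2` at every input in the input space `X`. -/
def hypothesisClass {D : ℕ} (M : ℕ) (ρ : ℝ → ℝ) (X : Set (EuclideanSpace ℝ (Fin D)))
    (C₃ C₄ dmin : ℝ) : Set (EuclideanSpace ℝ (Fin D) → ℝ) :=
  {f | ∃ (W : Fin M → EuclideanSpace ℝ (Fin D)) (v : Fin M → ℝ),
      (∀ m, ‖W m‖ ≤ C₃) ∧ ‖v‖ ≤ C₄ ∧ (∀ x ∈ X, dmin ^ 2 ≤ diversity ρ W x) ∧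
      f = network ρ W v}

/-- The squared loss `½ |t - y|²`. -/
def sqLoss (t y : ℝ) : ℝ := 1 / 2 * |t - y| ^ 2

/-- The expected risk `L(f) = E_{(x,y) ∼ Q} [l(f(x), y)]`. -/
def risk {D : ℕ} (Q : MeasureTheory.Measure (EuclideanSpace ℝ (Fin D) × ℝ))
    (f : EuclideanSpace ℝ (Fin D) → ℝ) : ℝ :=
  ∫ z, sqLoss (f z.1) z.2 ∂Q

/-- The empirical risk of `f` on the sample `S = ((x₁, y₁), …, (x_N, y_N))`. -/
def empRisk {D N : ℕ} (S : Fin N → EuclideanSpace ℝ (Fin D) × ℝ)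
    (f : EuclideanSpace ℝ (Fin D) → ℝ) : ℝ :=
  1 / (N : ℝ) * ∑ i, sqLoss (f (S i).1) (S i).2

/-- `f ∈ argmin_{g ∈ F} R(g)`. -/
def IsArgmin {α : Type*} (R : α → ℝ) (F : Set α) (f : α) : Prop :=
  f ∈ F ∧ ∀ g ∈ F, R f ≤ R g

/-- `C₅ = L_ρ C₁ C₃ + ρ(0)`. -/
def constC5 (ρ : ℝ → ℝ) (L C₁ C₃ : ℝ) : ℝ := L * C₁ * C₃ + ρ 0

/-- `J = C₄² (M C₅² + M (M - 1) (C₅² - dmin²))`. -/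
def constJ (M : ℕ) (C₄ C₅ dmin : ℝ) : ℝ :=
  C₄ ^ 2 * ((M : ℝ) * C₅ ^ 2 + (M : ℝ) * ((M : ℝ) - 1) * (C₅ ^ 2 - dmin ^ 2))

/-- `A = 4 (2 L_ρ C₁ C₃ C₄ + C₄ |ρ(0)|) M`. -/
def constA (M : ℕ) (ρ : ℝ → ℝ) (L C₁ C₃ C₄ : ℝ) : ℝ :=
  4 * (2 * L * (C₁ * C₃ * C₄) + C₄ * |ρ 0|) * (M : ℝ)

end DiverseNet

end

/-! Everything rests on one pointwise estimate and one uniform deviation bound. For the estimate,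
`(∑ φ_m)² = M ∑ φ_m² - ½ ∑_{n≠m} (φ_n - φ_m)²`. With `0 ≤ φ_m ≤ C₅`, the diversity bound therefore
subtracts `M (M - 1) dmin²` from `M² C₅²`, and `|f| ≤ √J` on the input space (`abs_network_le`).
Writing `B = √J + C₂`, the loss takes almost surely values in `[0, B²/2]` and is `B`-Lipschitz in
the output.

For the deviation, the reference loss of `f*` is subtracted from every loss, and only the one-sided
supremum of (excess risk minus empirical excess risk) is controlled. Its mean is bounded by
symmetrization (`integral_iSup_symmetrization`); the reference drops out because the signs average
to zero. Contraction then passes from losses to outputs and from features to linear functionals,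
whose average is estimated in the Hilbert norm. Fluctuations around the mean are handled by
McDiarmid (`measureReal_pi_ge_le`). Since an empirical minimizer has nonpositive empirical excess
risk, the deviation bound is already a risk bound.

Suprema are only taken over finite classes. A dense sequence of parameters is exhausted by finite
segments, and continuity in the parameters gives the whole class. -/

namespace DiverseNet

/-! ### Rademacher averages, written as unnormalized sums over all `2 ^ n` sign patterns. -/

section Rademacher

/-- The Rademacher sign attached to a Boolean. -/
def boolSign (b : Bool) : ℝ := if b then 1 else -1

@[simp] lemma boolSign_true : boolSign true = 1 := rfl

@[simp] lemma boolSign_false : boolSign false = -1 := rfl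

/-- Conditioning on the first sign; this drives the inductions over sign patterns. -/
lemma sum_fin_succ_bool {n : ℕ} (F : (Fin (n + 1) → Bool) → ℝ) :
    ∑ ε, F ε = ∑ ε : Fin n → Bool, (F (Fin.cons true ε) + F (Fin.cons false ε)) := by
  rw [← (Fin.consEquiv fun _ => Bool).sum_comp, Fintype.sum_prod_type, Fintype.sum_bool,
    ← Finset.sum_add_distrib]
  rfl

variable {ι : Type*}

lemma le_ciSup_of_finite [Finite ι] (f : ι → ℝ) (j : ι) : f j ≤ ⨆ k, f k :=
  le_ciSup (Set.finite_range f).bddAbove j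

/-- The contraction principle for a single sign. For a pair `j`, `k` the left side is at most `p j +
p k + |b j - b k|`; the sign of `b j - b k` decides which of the two indices is tested in which
supremum on the right. -/
lemma iSup_add_iSup_sub_le [Finite ι] [Nonempty ι] (p a b : ι → ℝ) (h : ∀ j k, |a j - a k| ≤ |b j - b k|) :
    (⨆ j, (p j + a j)) + ⨆ j, (p j - a j) ≤ (⨆ j, (p j + b j)) + ⨆ j, (p j - b j) := by
  suffices H : ∀ j k, (p j + a j) + (p k - a k) ≤
      (⨆ j, (p j + b j)) + ⨆ j, (p j - b j) by
    rw [← le_sub_iff_add_le]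
    refine ciSup_le fun j => ?_
    rw [le_sub_comm]
    refine ciSup_le fun k => ?_
    linarith [H j k]
  intro j k
  have h1 := (le_abs_self _).trans (h j k)
  have e1 := le_ciSup_of_finite (fun j => p j + b j)
  have e2 := le_ciSup_of_finite (fun j => p j - b j)
  rcases abs_cases (b j - b k) with ⟨hb, -⟩ | ⟨hb, -⟩
  · linarith [e1 j, e2 k]
  · linarith [e1 k, e2 j]

/-- The contraction principle for Rademacher averages over a finite class. -/
lemma sum_iSup_sign_contraction [Finite ι] [Nonempty ι] {n : ℕ} (r : ι → ℝ) (a b : ι → Fin n → ℝ)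
    (h : ∀ j k i, |a j i - a k i| ≤ |b j i - b k i|) :
    ∑ ε : Fin n → Bool, ⨆ j, (r j + ∑ i, boolSign (ε i) * a j i) ≤
      ∑ ε : Fin n → Bool, ⨆ j, (r j + ∑ i, boolSign (ε i) * b j i) := by
  -- The offset `r` must vary: it absorbs the coordinates in which `a` has already been exchanged
  -- for `b`.
  induction n generalizing r with
  | zero => simp
  | succ n ih =>
    simp only [sum_fin_succ_bool, Fin.sum_univ_succ, Fin.cons_zero, Fin.cons_succ,
      boolSign_true, boolSign_false, one_mul, neg_mul]
    calc _ ≤ ∑ ε : Fin n → Bool,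
          ((⨆ j, ((r j + b j 0) + ∑ i : Fin n, boolSign (ε i) * a j i.succ)) +
            ⨆ j, ((r j - b j 0) + ∑ i : Fin n, boolSign (ε i) * a j i.succ)) := by
          refine Finset.sum_le_sum fun ε _ => ?_
          have := iSup_add_iSup_sub_le (fun j => r j + ∑ i : Fin n, boolSign (ε i) * a j i.succ)
            (fun j => a j 0) (fun j => b j 0) (fun j k => h j k 0)
          simpa only [sub_eq_add_neg, add_assoc, add_comm, add_left_comm] using this
      _ ≤ _ := by
          rw [Finset.sum_add_distrib, Finset.sum_add_distrib]
          refine (add_le_add (ih (fun j => r j + b j 0) (fun j i => a j i.succ)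
            (fun j i => b j i.succ) fun j k i => h j k _) (ih (fun j => r j - b j 0)
            (fun j i => a j i.succ) (fun j i => b j i.succ) fun j k i => h j k _)).trans_eq ?_
          simp only [sub_eq_add_neg, add_assoc]

variable {E : Type*} [NormedAddCommGroup E] [InnerProductSpace ℝ E]

/-- Cross terms cancel on averaging over signs; each sign contributes one parallelogram law. -/
lemma sum_norm_sq_sign_sum {n : ℕ} (p : E) (x : Fin n → E) :
    ∑ ε : Fin n → Bool, ‖p + ∑ i, boolSign (ε i) • x i‖ ^ 2 =
      2 ^ n * (‖p‖ ^ 2 + ∑ i, ‖x i‖ ^ 2) := by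
  induction n generalizing p with
  | zero => simp
  | succ n ih =>
    simp only [sum_fin_succ_bool, Fin.sum_univ_succ, Fin.cons_zero, Fin.cons_succ,
      boolSign_true, boolSign_false, one_smul, neg_smul, ← add_assoc]
    rw [Finset.sum_add_distrib, ih, ih]
    have := parallelogram_law_with_norm ℝ p (x 0)
    rw [← sub_eq_add_neg, pow_succ]
    linear_combination (2 ^ n : ℝ) * this

lemma sum_norm_sign_sum_le {n : ℕ} (x : Fin n → E) {C : ℝ} (hC : 0 ≤ C)
    (hx : ∀ i, ‖x i‖ ≤ C) :
    ∑ ε : Fin n → Bool, ‖∑ i, boolSign (ε i) • x i‖ ≤ 2 ^ n * (√n * C) := by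
  refine abs_le_of_sq_le_sq' ?_ (by positivity) |>.2
  -- Cauchy–Schwarz over the sign patterns reduces the first moment to the second.
  refine (sq_sum_le_card_mul_sum_sq).trans ?_
  have h := sum_norm_sq_sign_sum 0 x
  simp only [zero_add, norm_zero, ne_eq, OfNat.ofNat_ne_zero, not_false_eq_true, zero_pow] at h
  rw [h]
  have h2 : ∑ i, ‖x i‖ ^ 2 ≤ n * C ^ 2 := by
    refine (Finset.sum_le_card_nsmul _ _ (C ^ 2) fun i _ => ?_).trans_eq (by simp)
    exact pow_le_pow_left₀ (norm_nonneg _) (hx i) 2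
  simp only [Finset.card_univ, Fintype.card_pi, Fintype.card_bool, Finset.prod_const,
    Fintype.card_fin, Nat.cast_pow, Nat.cast_ofNat, mul_pow, Real.sq_sqrt (Nat.cast_nonneg n)]
  rw [sq ((2 : ℝ) ^ n), mul_assoc]
  gcongr

/-- The Rademacher average of the class of norm-bounded linear functionals. -/
lemma sum_iSup_sign_inner_le [Nonempty ι] {n : ℕ} (x : Fin n → E) (w : ι → E) {C B : ℝ}
    (hC : 0 ≤ C) (hx : ∀ i, ‖x i‖ ≤ C) (hB : 0 ≤ B) (hw : ∀ j, ‖w j‖ ≤ B) :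
    ∑ ε : Fin n → Bool, ⨆ j, ∑ i, boolSign (ε i) * inner ℝ (w j) (x i) ≤
      2 ^ n * (√n * (C * B)) := by
  calc _ ≤ ∑ ε : Fin n → Bool, B * ‖∑ i, boolSign (ε i) • x i‖ := by
        refine Finset.sum_le_sum fun ε _ => ciSup_le fun j => ?_
        have : ∑ i, boolSign (ε i) * inner ℝ (w j) (x i) =
            inner ℝ (w j) (∑ i, boolSign (ε i) • x i) := by
          simp [inner_sum, inner_smul_right]
        rw [this]
        exact (real_inner_le_norm _ _).trans (by gcongr; exact hw j)
    _ ≤ B * (2 ^ n * (√n * C)) := by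
        rw [← Finset.mul_sum]
        gcongr
        exact sum_norm_sign_sum_le x hC hx
    _ = _ := by ring

/-- Contraction against the linear functionals with weights `K • w j`, so the Lipschitz constant
only rescales the weight ball. -/
lemma sum_iSup_sign_lipschitz_le [Finite ι] [Nonempty ι] {n : ℕ} (x : Fin n → E) (w : ι → E) {C B : ℝ}
    (hC : 0 ≤ C) (hx : ∀ i, ‖x i‖ ≤ C) (hB : 0 ≤ B) (hw : ∀ j, ‖w j‖ ≤ B)
    {K : ℝ≥0} {φ : ℝ → ℝ} (hφ : LipschitzWith K φ) :
    ∑ ε : Fin n → Bool, ⨆ j, ∑ i, boolSign (ε i) * φ (inner ℝ (w j) (x i)) ≤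
      2 ^ n * (√n * (K * C * B)) := by
  have h := sum_iSup_sign_contraction (fun _ => 0)
    (fun j i => φ (inner ℝ (w j) (x i))) (fun j i => inner ℝ ((K : ℝ) • w j) (x i))
    (fun j k i => by
      have := hφ.dist_le_mul (inner ℝ (w j) (x i)) (inner ℝ (w k) (x i))
      simp only [Real.dist_eq] at this
      rwa [real_inner_smul_left, real_inner_smul_left, ← mul_sub, abs_mul, NNReal.abs_eq])
  simp only [zero_add] at h
  refine h.trans ((sum_iSup_sign_inner_le x (fun j => (K : ℝ) • w j) hC hx
    (B := K * B) (by positivity) fun j => ?_).trans_eq (by ring))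
  rw [norm_smul, Real.norm_of_nonneg K.coe_nonneg]
  exact mul_le_mul_of_nonneg_left (hw j) K.coe_nonneg

lemma sum_iSup_abs_sign_lipschitz_le [Finite ι] [Nonempty ι] {n : ℕ} (x : Fin n → E) (w : ι → E) {C B : ℝ}
    (hC : 0 ≤ C) (hx : ∀ i, ‖x i‖ ≤ C) (hB : 0 ≤ B) (hw : ∀ j, ‖w j‖ ≤ B)
    {K : ℝ≥0} {φ : ℝ → ℝ} (hφ : LipschitzWith K φ) (hφ0 : φ 0 = 0) :
    ∑ ε : Fin n → Bool, ⨆ j, |∑ i, boolSign (ε i) * φ (inner ℝ (w j) (x i))| ≤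
      2 ^ n * (√n * (2 * K * C * B)) := by
  -- Adjoining the zero weight makes the suprema for `φ` and `-φ` both nonnegative, as `φ 0 = 0`.
  -- Their sum then dominates the supremum of absolute values; this is the source of the factor 2.
  let w' : Option ι → E := fun o => o.elim 0 w
  have hw' : ∀ o, ‖w' o‖ ≤ B := by
    rintro (_ | j)
    · simpa [w'] using hB
    · exact hw j
  have h1 := sum_iSup_sign_lipschitz_le x w' hC hx hB hw' hφ
  have h2 := sum_iSup_sign_lipschitz_le x w' hC hx hB hw' (φ := fun t => -φ t) hφ.neg
  calc _ ≤ ∑ ε : Fin n → Bool, ((⨆ o, ∑ i, boolSign (ε i) * φ (inner ℝ (w' o) (x i))) +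
        ⨆ o, ∑ i, boolSign (ε i) * -φ (inner ℝ (w' o) (x i))) := by
        refine Finset.sum_le_sum fun ε _ => ciSup_le fun j => ?_
        have e1 := le_ciSup_of_finite
          (fun o => ∑ i, boolSign (ε i) * φ (inner ℝ (w' o) (x i)))
        have e2 := le_ciSup_of_finite
          (fun o => ∑ i, boolSign (ε i) * -φ (inner ℝ (w' o) (x i)))
        have e1n := e1 none
        have e2n := e2 none
        have e1j := e1 (some j)
        have e2j := e2 (some j)
        simp only [w', Option.elim_none, Option.elim_some, inner_zero_left, hφ0, neg_zero,
          mul_zero, Finset.sum_const_zero, mul_neg, Finset.sum_neg_distrib] at e1n e2n e1j e2j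
        simp only [w', mul_neg, Finset.sum_neg_distrib]
        exact abs_le.2 ⟨by linarith, by linarith⟩
    _ ≤ _ := by
        rw [Finset.sum_add_distrib]
        linarith

/-- The Rademacher average of the class of one-hidden-layer networks. -/
lemma sum_iSup_sign_network_le [Finite ι] [Nonempty ι] {D M n : ℕ} {ρ : ℝ → ℝ} {K : ℝ≥0}
    (hρ : LipschitzWith K ρ) (W : ι → Fin M → EuclideanSpace ℝ (Fin D)) (v : ι → Fin M → ℝ)
    (x : Fin n → EuclideanSpace ℝ (Fin D)) {C B V : ℝ}
    (hC : 0 ≤ C) (hx : ∀ i, ‖x i‖ ≤ C) (hB : 0 ≤ B) (hW : ∀ j m, ‖W j m‖ ≤ B) (hV : 0 ≤ V)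
    (hv : ∀ j m, |v j m| ≤ V) :
    ∑ ε : Fin n → Bool, ⨆ j, ∑ i, boolSign (ε i) * network ρ (W j) (v j) (x i) ≤
      2 ^ n * (√n * (V * (2 * K * C * B + |ρ 0|) * M)) := by
  -- Recentring supplies `φ 0 = 0`; the constant part `ρ 0` is a sign sum of ones and is estimated
  -- separately.
  let φ : ℝ → ℝ := fun t => ρ t - ρ 0
  have hφ : LipschitzWith K φ := by
    refine LipschitzWith.of_dist_le_mul fun s t => ?_
    simpa [φ] using hρ.dist_le_mul s t
  calc _ ≤ ∑ ε : Fin n → Bool, ∑ m, V *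
        ((⨆ j, |∑ i, boolSign (ε i) * φ (inner ℝ (W j m) (x i))|) +
          |ρ 0| * ‖∑ i, boolSign (ε i) • (1 : ℝ)‖) := by
        refine Finset.sum_le_sum fun ε _ => ciSup_le fun j => ?_
        have : ∑ i, boolSign (ε i) * network ρ (W j) (v j) (x i) =
            ∑ m, v j m * ((∑ i, boolSign (ε i) * φ (inner ℝ (W j m) (x i))) +
              ρ 0 * ∑ i, boolSign (ε i) • (1 : ℝ)) := by
          simp only [network, feature, φ, Finset.mul_sum, ← Finset.sum_add_distrib]
          rw [Finset.sum_comm]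
          refine Finset.sum_congr rfl fun m _ => Finset.sum_congr rfl fun i _ => ?_
          simp only [smul_eq_mul]
          ring
        rw [this]
        refine Finset.sum_le_sum fun m _ => (le_abs_self _).trans ?_
        rw [abs_mul]
        refine mul_le_mul (hv j m) ((abs_add_le _ _).trans ?_) (abs_nonneg _) hV
        rw [abs_mul, Real.norm_eq_abs]
        gcongr
        exact le_ciSup_of_finite
          (fun j => |∑ i, boolSign (ε i) * φ (inner ℝ (W j m) (x i))|) j
    _ = ∑ m : Fin M, V * ((∑ ε : Fin n → Bool,
          ⨆ j, |∑ i, boolSign (ε i) * φ (inner ℝ (W j m) (x i))|) +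
            |ρ 0| * ∑ ε : Fin n → Bool, ‖∑ i, boolSign (ε i) • (1 : ℝ)‖) := by
        rw [Finset.sum_comm]
        simp only [← Finset.mul_sum, Finset.sum_add_distrib]
    _ ≤ ∑ m : Fin M, V * (2 ^ n * (√n * (2 * K * C * B)) + |ρ 0| * (2 ^ n * (√n * 1))) := by
        gcongr with m
        · exact sum_iSup_abs_sign_lipschitz_le x (fun j => W j m) hC hx hB
            (fun j => hW j m) hφ (by simp [φ])
        · exact sum_norm_sign_sum_le _ zero_le_one (by simp)
    _ = _ := by
        simp only [Finset.sum_const, Finset.card_univ, Fintype.card_fin, nsmul_eq_mul]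
        ring

end Rademacher

/-! ### Product measures, McDiarmid's inequality and symmetrization. -/

section Concentration

open MeasureTheory ProbabilityTheory

variable {Z : Type*} [MeasurableSpace Z] {Q : Measure Z}

lemma integrable_iSup_of_finite {ι : Type*} [Finite ι] [Nonempty ι] {f : ι → Z → ℝ}
    (hf : ∀ j, Integrable (f j) Q) : Integrable (fun z => ⨆ j, f j z) Q := by
  cases nonempty_fintype ι
  refine (integrable_finsetSum Finset.univ fun j _ => (hf j).abs).mono'
    (AEMeasurable.iSup fun j => (hf j).aemeasurable).aestronglyMeasurable
    (Filter.Eventually.of_forall fun z => ?_)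
  have h : ∀ j, |f j z| ≤ ∑ j, |f j z| := fun j =>
    Finset.single_le_sum (f := fun j => |f j z|) (fun _ _ => abs_nonneg _) (Finset.mem_univ j)
  rw [Real.norm_eq_abs, abs_le]
  refine ⟨?_, ciSup_le fun j => (le_abs_self _).trans (h j)⟩
  let j := Classical.arbitrary ι
  exact (neg_le_of_abs_le (h j)).trans (le_ciSup_of_finite (fun j => f j z) j)

variable [IsProbabilityMeasure Q]

/-- Splits off the first sample point, so that statements about i.i.d. samples can be proved one
coordinate at a time. -/
lemma measurePreserving_fin_cons (Q : Measure Z) [IsProbabilityMeasure Q] (n : ℕ) :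
    MeasurePreserving (fun p : Z × (Fin n → Z) => (Fin.cons p.1 p.2 : Fin (n + 1) → Z))
      (Q.prod (Measure.pi fun _ => Q)) (Measure.pi fun _ => Q) := by
  have h := (measurePreserving_piFinSuccAbove (fun _ : Fin (n + 1) => Q) 0).symm
  convert h using 1
  ext p i
  simp [MeasurableEquiv.piFinSuccAbove, Fin.insertNthEquiv]

lemma integrable_comp_fin_cons {n : ℕ} {F : (Fin (n + 1) → Z) → ℝ}
    (hF : Integrable F (Measure.pi fun _ => Q)) :
    Integrable (fun p : Z × (Fin n → Z) => F (Fin.cons p.1 p.2))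
      (Q.prod (Measure.pi fun _ => Q)) :=
  (measurePreserving_fin_cons Q n).integrable_comp_of_integrable hF

lemma integral_comp_fin_cons {n : ℕ} {F : (Fin (n + 1) → Z) → ℝ}
    (hF : Integrable F (Measure.pi fun _ => Q)) :
    ∫ S, F S ∂(Measure.pi fun _ => Q) =
      ∫ p, F (Fin.cons p.1 p.2) ∂(Q.prod (Measure.pi fun _ : Fin n => Q)) := by
  have h := measurePreserving_fin_cons Q n
  rw [← h.map_eq, integral_map h.aemeasurable]
  rw [h.map_eq]
  exact hF.aestronglyMeasurable

lemma integral_pi_fin_succ {n : ℕ} {F : (Fin (n + 1) → Z) → ℝ}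
    (hF : Integrable F (Measure.pi fun _ => Q)) :
    ∫ S, F S ∂(Measure.pi fun _ => Q) =
      ∫ z, ∫ S, F (Fin.cons z S) ∂(Measure.pi fun _ : Fin n => Q) ∂Q := by
  rw [integral_comp_fin_cons hF, integral_prod _ (integrable_comp_fin_cons hF)]

lemma integral_pi_fin_succ_symm {n : ℕ} {F : (Fin (n + 1) → Z) → ℝ}
    (hF : Integrable F (Measure.pi fun _ => Q)) :
    ∫ S, F S ∂(Measure.pi fun _ => Q) =
      ∫ S, ∫ z, F (Fin.cons z S) ∂Q ∂(Measure.pi fun _ : Fin n => Q) := by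
  rw [integral_comp_fin_cons hF, integral_prod_symm _ (integrable_comp_fin_cons hF)]

/-- Hoeffding's lemma for a function of bounded oscillation. -/
lemma integral_exp_sub_integral_le {G : Z → ℝ} (hG : Measurable G) {c : ℝ}
    (hc : ∀ z z', G z - G z' ≤ c) (t : ℝ) :
    ∫ z, Real.exp (t * (G z - ∫ z', G z' ∂Q)) ∂Q ≤ Real.exp (c ^ 2 * t ^ 2 / 8) := by
  obtain ⟨z₀⟩ : Nonempty Z := Q.nonempty_of_neZero
  have hbdd : BddBelow (Set.range G) := by
    refine ⟨G z₀ - c, ?_⟩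
    rintro _ ⟨z, rfl⟩
    linarith [hc z₀ z]
  have : Nonempty Z := ⟨z₀⟩
  have hmem : ∀ᵐ z ∂Q, G z ∈ Set.Icc (⨅ z, G z) ((⨅ z, G z) + c) := by
    refine Filter.Eventually.of_forall fun z => ⟨ciInf_le hbdd z, ?_⟩
    have : G z - c ≤ ⨅ z, G z := le_ciInf fun z' => by linarith [hc z z']
    linarith
  refine ((hasSubgaussianMGF_of_mem_Icc hG.aemeasurable hmem).mgf_le t).trans_eq ?_
  congr 1
  simp only [add_sub_cancel_left, NNReal.coe_pow, NNReal.coe_div, coe_nnnorm, Real.norm_eq_abs,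
    NNReal.coe_ofNat, div_pow, sq_abs]
  ring

/-- The moment generating function bound behind McDiarmid's bounded differences inequality. -/
lemma integral_exp_sub_integral_pi_le {n : ℕ} {g : (Fin n → Z) → ℝ} (hg : Measurable g) {K : ℝ}
    (hK : ∀ S, |g S| ≤ K) {c : ℝ}
    (hc : ∀ (i : Fin n) (S S' : Fin n → Z), (∀ j ≠ i, S j = S' j) → g S - g S' ≤ c) (t : ℝ) :
    ∫ S, Real.exp (t * (g S - ∫ S', g S' ∂(Measure.pi fun _ => Q))) ∂(Measure.pi fun _ => Q) ≤
      Real.exp (n * (c ^ 2 * t ^ 2 / 8)) := by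
  induction n with
  | zero =>
    have h : ∀ S, g S = g default := fun S => by rw [Subsingleton.elim S default]
    simp [h]
  | succ n ih =>
    have hint : ∀ {m : ℕ} {f : (Fin m → Z) → ℝ}, Measurable f → (∀ S, |f S| ≤ K) →
        Integrable f (Measure.pi fun _ => Q) := fun hf hb =>
      Integrable.of_bound hf.aestronglyMeasurable K (Filter.Eventually.of_forall hb)
    have hcons : ∀ z, Measurable fun S : Fin n → Z => (Fin.cons z S : Fin (n + 1) → Z) :=
      fun z => (measurePreserving_fin_cons Q n).measurable.comp measurable_prodMk_left
    -- The conditional mean given the first point. Hoeffding's lemma applies to `G`, whose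
    -- oscillation is at most `c`, and the induction hypothesis to `g` with that point frozen.
    let G : Z → ℝ := fun z => ∫ S, g (Fin.cons z S) ∂(Measure.pi fun _ : Fin n => Q)
    have hGm : Measurable G :=
      (hg.comp (measurePreserving_fin_cons Q n).measurable).stronglyMeasurable
        |>.integral_prod_right'.measurable
    have hgz : ∀ z, Integrable (fun S : Fin n → Z => g (Fin.cons z S)) (Measure.pi fun _ => Q) :=
      fun z => hint (hg.comp (hcons z)) fun S => hK _
    have hGc : ∀ z z', G z - G z' ≤ c := by
      intro z z'
      rw [← integral_sub (hgz z) (hgz z')]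
      refine (integral_mono ((hgz z).sub (hgz z')) (integrable_const c) fun S =>
        hc 0 _ _ fun j hj => ?_).trans_eq (by simp)
      obtain ⟨k, rfl⟩ := Fin.exists_succ_eq.2 hj
      simp
    have hEG : ∫ S, g S ∂(Measure.pi fun _ => Q) = ∫ z, G z ∂Q :=
      integral_pi_fin_succ (hint hg hK)
    set m := ∫ S, g S ∂(Measure.pi fun _ => Q) with hm
    have hexp : Integrable (fun S => Real.exp (t * (g S - m)))
        (Measure.pi fun _ : Fin (n + 1) => Q) := by
      refine Integrable.of_bound (by fun_prop) (Real.exp (|t| * (K + |m|)))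
        (Filter.Eventually.of_forall fun S => ?_)
      rw [Real.norm_eq_abs, Real.abs_exp, Real.exp_le_exp]
      refine (le_abs_self _).trans ?_
      rw [abs_mul]
      gcongr
      exact (abs_sub _ _).trans (by gcongr; exact hK S)
    have hGexp : Integrable (fun z => Real.exp (t * (G z - m))) Q := by
      refine Integrable.of_bound (by fun_prop) (Real.exp (|t| * c))
        (Filter.Eventually.of_forall fun z => ?_)
      rw [Real.norm_eq_abs, Real.abs_exp, Real.exp_le_exp]
      refine (le_abs_self _).trans ?_
      rw [abs_mul]
      gcongr
      have hGi : Integrable G Q := (integrable_comp_fin_cons (hint hg hK)).integral_prod_left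
      rw [hEG, abs_le]
      constructor
      · have : ∫ z', G z' ∂Q ≤ ∫ _, (G z + c) ∂Q :=
          integral_mono hGi (integrable_const _) fun z' => by simp only []; linarith [hGc z' z]
        simp only [integral_const, probReal_univ, one_smul] at this
        linarith
      · have : ∫ _, (G z - c) ∂Q ≤ ∫ z', G z' ∂Q :=
          integral_mono (integrable_const _) hGi fun z' => by simp only []; linarith [hGc z z']
        simp only [integral_const, probReal_univ, one_smul] at this
        linarith
    rw [integral_pi_fin_succ hexp]
    calc _ ≤ ∫ z, Real.exp (t * (G z - m)) * Real.exp (n * (c ^ 2 * t ^ 2 / 8)) ∂Q := by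
          refine integral_mono (integrable_comp_fin_cons hexp).integral_prod_left
            (hGexp.mul_const _) fun z => ?_
          have h := ih (g := fun S => g (Fin.cons z S)) (hg.comp (hcons z)) (fun S => hK _)
            (fun i S S' hS => hc i.succ _ _ fun j hj => by
              refine Fin.cases (fun _ => rfl) (fun k hk => ?_) j hj
              simpa using hS k (by simpa using hk))
          have e : ∀ S : Fin n → Z, Real.exp (t * (g (Fin.cons z S) - m)) =
              Real.exp (t * (G z - m)) * Real.exp (t * (g (Fin.cons z S) - G z)) := by
            intro S
            rw [← Real.exp_add]
            ring_nf
          simp only [e]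
          rw [integral_const_mul]
          exact mul_le_mul_of_nonneg_left h (Real.exp_nonneg _)
      _ ≤ Real.exp (c ^ 2 * t ^ 2 / 8) * Real.exp (n * (c ^ 2 * t ^ 2 / 8)) := by
          rw [integral_mul_const, hEG]
          gcongr
          exact integral_exp_sub_integral_le hGm hGc t
      _ = _ := by
          rw [← Real.exp_add]
          push_cast
          ring_nf

/-- **McDiarmid's inequality** for a function with bounded differences. -/
lemma measureReal_pi_ge_le {n : ℕ} (hn : 0 < n) {g : (Fin n → Z) → ℝ} (hg : Measurable g) {K : ℝ}
    (hK : ∀ S, |g S| ≤ K) {c : ℝ} (hc0 : 0 < c)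
    (hc : ∀ (i : Fin n) (S S' : Fin n → Z), (∀ j ≠ i, S j = S' j) → g S - g S' ≤ c)
    {s : ℝ} (hs : 0 ≤ s) :
    (Measure.pi fun _ : Fin n => Q).real {S | ∫ S', g S' ∂(Measure.pi fun _ => Q) + s ≤ g S} ≤
      Real.exp (-2 * s ^ 2 / (n * c ^ 2)) := by
  set m := ∫ S, g S ∂(Measure.pi fun _ => Q) with hm
  -- The minimizer of the Chernoff exponent `-t s + n c² t² / 8`.
  set t := 4 * s / (n * c ^ 2) with ht
  have hn' : (0 : ℝ) < n := by exact_mod_cast hn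
  have hint : Integrable (fun S => Real.exp (t * (g S - m)))
        (Measure.pi fun _ : Fin n => Q) := by
    refine Integrable.of_bound (by fun_prop) (Real.exp (|t| * (K + |m|)))
      (Filter.Eventually.of_forall fun S => ?_)
    rw [Real.norm_eq_abs, Real.abs_exp, Real.exp_le_exp]
    refine (le_abs_self _).trans ?_
    rw [abs_mul]
    gcongr
    exact (abs_sub _ _).trans (by gcongr; exact hK S)
  have h1 := measure_ge_le_exp_mul_mgf (X := fun S => g S - m) s (by positivity : 0 ≤ t) hint
  have h2 : mgf (fun S => g S - m) (Measure.pi fun _ : Fin n => Q) t ≤ _ :=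
    integral_exp_sub_integral_pi_le hg hK hc t
  have e : {S | m + s ≤ g S} = {S | s ≤ g S - m} := by
    ext S
    simp only [Set.mem_ofPred_eq]
    constructor <;> intro h <;> linarith
  rw [e]
  refine h1.trans ((mul_le_mul_of_nonneg_left h2 (Real.exp_nonneg _)).trans_eq ?_)
  rw [← Real.exp_add]
  congr 1
  rw [ht]
  field_simp
  ring

/-- Symmetrization for a finite class of functions. -/
lemma integral_iSup_symmetrization {ι : Type*} [Finite ι] [Nonempty ι] {n : ℕ} (r : ι → ℝ)
    {u : ι → Z → ℝ} (hu : ∀ j, Integrable (u j) Q) :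
    2 ^ n * ∫ S, (⨆ j, (r j + ∑ i, (∫ z, u j z ∂Q - u j (S i)))) ∂(Measure.pi fun _ : Fin n => Q) ≤
      ∑ ε : Fin n → Bool, ∫ S, (⨆ j, (r j + ∑ i, boolSign (ε i) * (2 * u j (S i))))
        ∂(Measure.pi fun _ : Fin n => Q) := by
  have hui : ∀ {n : ℕ} (j) (i : Fin n), Integrable (fun S => u j (S i)) (Measure.pi fun _ => Q) :=
    fun j i => (measurePreserving_eval (fun _ => Q) i).integrable_comp_of_integrable (hu j)
  have hF : ∀ {n : ℕ} (r : ι → ℝ), Integrable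
      (fun S : Fin n → Z => ⨆ j, (r j + ∑ i, (∫ z, u j z ∂Q - u j (S i))))
      (Measure.pi fun _ => Q) := fun r =>
    integrable_iSup_of_finite fun j => (integrable_const _).add <|
      integrable_finsetSum _ fun i _ => (integrable_const _).sub (hui j i)
  have hR : ∀ {n : ℕ} (r : ι → ℝ) (ε : Fin n → Bool), Integrable
      (fun S : Fin n → Z => ⨆ j, (r j + ∑ i, boolSign (ε i) * (2 * u j (S i))))
      (Measure.pi fun _ => Q) := fun r ε =>
    integrable_iSup_of_finite fun j => (integrable_const _).add <|
      integrable_finsetSum _ fun i _ => ((hui j i).const_mul _).const_mul _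
  -- Symmetrization of one coordinate without a ghost sample: the term is the mean of `p j + 2 ∫ u
  -- j` and `p j - 2 u j z`, and the former is at most the integral of `⨆ j, (p j + 2 u j)`.
  have hone : ∀ p : ι → ℝ, 2 * ∫ z, (⨆ j, (p j + (∫ z, u j z ∂Q - u j z))) ∂Q ≤
      ∫ z, (⨆ j, (p j + 2 * u j z)) ∂Q + ∫ z, (⨆ j, (p j - 2 * u j z)) ∂Q := by
    intro p
    have i0 : Integrable (fun z => ⨆ j, (p j + (∫ z, u j z ∂Q - u j z))) Q :=
      integrable_iSup_of_finite fun j => (integrable_const _).add ((integrable_const _).sub (hu j))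
    have i1 : Integrable (fun z => ⨆ j, (p j + 2 * u j z)) Q :=
      integrable_iSup_of_finite fun j => (integrable_const _).add ((hu j).const_mul _)
    have i2 : Integrable (fun z => ⨆ j, (p j - 2 * u j z)) Q :=
      integrable_iSup_of_finite fun j => (integrable_const _).sub ((hu j).const_mul _)
    have h1 : ∀ j, p j + 2 * ∫ z, u j z ∂Q ≤ ∫ z, (⨆ j, (p j + 2 * u j z)) ∂Q := by
      intro j
      have : p j + 2 * ∫ z, u j z ∂Q = ∫ z, (p j + 2 * u j z) ∂Q := by
        rw [integral_add (integrable_const _) ((hu j).const_mul _), integral_const_mul]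
        simp
      rw [this]
      exact integral_mono ((integrable_const _).add ((hu j).const_mul _)) i1 fun z =>
        le_ciSup_of_finite (fun j => p j + 2 * u j z) j
    set I := ∫ z, (⨆ j, (p j + 2 * u j z)) ∂Q with hI
    have h2 : ∫ z, (I + ⨆ j, (p j - 2 * u j z)) ∂Q = I + ∫ z, (⨆ j, (p j - 2 * u j z)) ∂Q := by
      rw [integral_add (integrable_const _) i2]
      simp
    rw [← h2, ← integral_const_mul]
    refine integral_mono (i0.const_mul _) ((integrable_const _).add i2) fun z => ?_
    simp only []
    have : (⨆ j, (p j + (∫ z, u j z ∂Q - u j z))) ≤ (I + ⨆ j, (p j - 2 * u j z)) / 2 :=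
      ciSup_le fun j => by
        have := le_ciSup_of_finite (fun j => p j - 2 * u j z) j
        linarith [h1 j]
    linarith
  induction n generalizing r with
  | zero => simp
  | succ n ih =>
    have hsnd : ∀ j (i : Fin n), Integrable (fun p : Z × (Fin n → Z) => u j (p.2 i))
        (Q.prod (Measure.pi fun _ => Q)) := fun j i => (hui j i).comp_snd Q
    have hfst : ∀ j, Integrable (fun p : Z × (Fin n → Z) => u j p.1)
        (Q.prod (Measure.pi fun _ => Q)) := fun j => (hu j).comp_fst _
    have hi : ∀ ε : Fin n → Bool, Integrable (fun p : Z × (Fin n → Z) =>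
        ⨆ j, (r j + (∫ z, u j z ∂Q - u j p.1) + ∑ i, boolSign (ε i) * (2 * u j (p.2 i))))
        (Q.prod (Measure.pi fun _ => Q)) := fun ε =>
      integrable_iSup_of_finite fun j => by
        refine ((integrable_const _).add ((integrable_const _).sub (hfst j))).add ?_
        exact integrable_finsetSum _ fun i _ => ((hsnd j i).const_mul _).const_mul _
    calc _ = 2 * ∫ z, 2 ^ n * ∫ S, (⨆ j, (r j + (∫ z, u j z ∂Q - u j z) +
          ∑ i, (∫ z, u j z ∂Q - u j (S i)))) ∂(Measure.pi fun _ : Fin n => Q) ∂Q := by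
          rw [integral_pi_fin_succ (hF r), integral_const_mul]
          simp only [Fin.sum_univ_succ, Fin.cons_zero, Fin.cons_succ, add_assoc]
          ring
      _ ≤ 2 * ∫ z, ∑ ε : Fin n → Bool, ∫ S, (⨆ j, (r j + (∫ z, u j z ∂Q - u j z) +
          ∑ i, boolSign (ε i) * (2 * u j (S i)))) ∂(Measure.pi fun _ : Fin n => Q) ∂Q := by
          refine mul_le_mul_of_nonneg_left ?_ zero_le_two
          have h1 := (integrable_comp_fin_cons (hF (n := n + 1) r)).integral_prod_left
          simp only [Fin.sum_univ_succ, Fin.cons_zero, Fin.cons_succ, ← add_assoc] at h1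
          have h2 := integrable_finsetSum Finset.univ fun ε _ => (hi ε).integral_prod_left
          exact integral_mono (h1.const_mul _) h2
            fun z => ih fun j => r j + (∫ z, u j z ∂Q - u j z)
      _ = ∑ ε : Fin n → Bool, ∫ S, 2 * ∫ z, (⨆ j, (r j + ∑ i, boolSign (ε i) * (2 * u j (S i)) +
          (∫ z, u j z ∂Q - u j z))) ∂Q ∂(Measure.pi fun _ : Fin n => Q) := by
          rw [integral_finsetSum _ fun ε _ => (hi ε).integral_prod_left, Finset.mul_sum]
          refine Finset.sum_congr rfl fun ε _ => ?_
          -- With the other points already carrying signs, the first is made the inner variable so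
          -- that `hone` applies to it.
          rw [integral_integral_swap (hi ε), integral_const_mul]
          simp only [add_right_comm]
      _ ≤ ∑ ε : Fin n → Bool, ((∫ S, (⨆ j, (r j + ∑ i,
              boolSign ((Fin.cons true ε : Fin (n + 1) → Bool) i) * (2 * u j (S i))))
            ∂(Measure.pi fun _ : Fin (n + 1) => Q)) + ∫ S, (⨆ j, (r j + ∑ i,
              boolSign ((Fin.cons false ε : Fin (n + 1) → Bool) i) * (2 * u j (S i))))
            ∂(Measure.pi fun _ : Fin (n + 1) => Q)) := by
          refine Finset.sum_le_sum fun ε _ => ?_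
          rw [integral_pi_fin_succ_symm (hR r _), integral_pi_fin_succ_symm (hR r _)]
          have it := (integrable_comp_fin_cons (hR r (Fin.cons true ε))).integral_prod_right
          have jf := (integrable_comp_fin_cons (hR r (Fin.cons false ε))).integral_prod_right
          rw [← integral_add it jf]
          refine integral_mono ?_ (it.add jf) fun S => ?_
          · refine ((hi ε).integral_prod_right.const_mul 2).congr (.of_forall fun S => ?_)
            simp only [add_right_comm]
          · refine (hone fun j => r j + ∑ i, boolSign (ε i) * (2 * u j (S i))).trans_eq ?_
            simp only [Fin.sum_univ_succ, Fin.cons_zero, Fin.cons_succ, boolSign_true,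
              boolSign_false, one_mul, neg_mul, sub_eq_add_neg, add_comm,
              add_left_comm]
      _ = _ := by rw [sum_fin_succ_bool]

end Concentration

/-! ### One-sided uniform deviations over finite and countable classes. -/

section Deviation

open MeasureTheory

lemma sum_add_sign_sum {n : ℕ} (p : ℝ) (a : Fin n → ℝ) :
    ∑ ε : Fin n → Bool, (p + ∑ i, boolSign (ε i) * a i) = 2 ^ n * p := by
  induction n generalizing p with
  | zero => simp
  | succ n ih =>
    simp only [sum_fin_succ_bool, Fin.sum_univ_succ, Fin.cons_zero, Fin.cons_succ,
      boolSign_true, boolSign_false, one_mul, neg_mul]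
    have h1 := ih (p + a 0) fun i => a i.succ
    have h2 := ih (p - a 0) fun i => a i.succ
    simp only [sub_eq_add_neg, add_assoc] at h1 h2
    rw [Finset.sum_add_distrib, h1, h2]
    ring

/-- A shift common to the whole class leaves the supremum, and its signed sums cancel over all
patterns. Hence comparing with a reference loss does not enlarge the complexity. -/
lemma sum_iSup_sign_sub_le {ι : Type*} [Finite ι] [Nonempty ι] {n : ℕ} (a : ι → Fin n → ℝ)
    (b : Fin n → ℝ) :
    ∑ ε : Fin n → Bool, ⨆ j, ∑ i, boolSign (ε i) * (a j i - b i) ≤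
      ∑ ε : Fin n → Bool, ⨆ j, ∑ i, boolSign (ε i) * a j i := by
  have hb := sum_add_sign_sum 0 b
  simp only [zero_add, mul_zero] at hb
  rw [← sub_zero (∑ ε : Fin n → Bool, ⨆ j, ∑ i, boolSign (ε i) * a j i), ← hb,
    ← Finset.sum_sub_distrib]
  refine Finset.sum_le_sum fun ε _ => ciSup_le fun j => ?_
  simp only [mul_sub, Finset.sum_sub_distrib]
  gcongr
  exact le_ciSup_of_finite (fun j => ∑ i, boolSign (ε i) * a j i) j

variable {Z : Type*} [MeasurableSpace Z] {Q : Measure Z} [IsProbabilityMeasure Q]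

/-- One-sided uniform deviation bound for a finite class of losses with values in `[0, c]`,
relative to a reference loss, in terms of a bound on the empirical Rademacher averages. -/
lemma le_measureReal_deviation_of_finite {ι : Type*} [Finite ι] [Nonempty ι] {N : ℕ} (hN : 0 < N)
    {h : ι → Z → ℝ} (hm : ∀ j, Measurable (h j)) {h₀ : Z → ℝ} (hm₀ : Measurable h₀) {c : ℝ}
    (h0 : ∀ j z, 0 ≤ h j z) (hc : ∀ j z, h j z ≤ c) (h₀0 : ∀ z, 0 ≤ h₀ z) (h₀c : ∀ z, h₀ z ≤ c)
    {R : ℝ} (hR : ∀ S : Fin N → Z,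
      ∑ ε : Fin N → Bool, ⨆ j, ∑ i, boolSign (ε i) * h j (S i) ≤ 2 ^ N * R)
    {δ : ℝ} (hδ₀ : 0 < δ) (hδ₁ : δ < 1) :
    1 - δ ≤ (Measure.pi fun _ : Fin N => Q).real {S | ∀ j,
      ∑ i, ((∫ z, h j z ∂Q - ∫ z, h₀ z ∂Q) - (h j (S i) - h₀ (S i))) ≤
        2 * R + c * √(2 * N * Real.log (1 / δ))} := by
  obtain ⟨z₀⟩ : Nonempty Z := Q.nonempty_of_neZero
  have hc0 : 0 ≤ c := (h₀0 z₀).trans (h₀c z₀)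
  -- McDiarmid needs a positive oscillation bound; for `c = 0` all losses vanish and the hypothesis
  -- on `R` forces `0 ≤ R`.
  rcases hc0.eq_or_lt with rfl | hcpos
  · have e : ∀ j z, h j z = 0 := fun j z => le_antisymm (hc j z) (h0 j z)
    have e₀ : ∀ z, h₀ z = 0 := fun z => le_antisymm (h₀c z) (h₀0 z)
    have hR0 : 0 ≤ R := by
      have := hR fun _ => z₀
      simp only [e, mul_zero, Finset.sum_const_zero, ciSup_const] at this
      exact nonneg_of_mul_nonneg_right this (by positivity)
    simp [e, e₀, hR0, hδ₀.le]
  have hi : ∀ j, Integrable (h j) Q := fun j =>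
    Integrable.of_bound (hm j).aestronglyMeasurable c (.of_forall fun z => by
      rw [Real.norm_of_nonneg (h0 j z)]; exact hc j z)
  have hi₀ : Integrable h₀ Q :=
    Integrable.of_bound hm₀.aestronglyMeasurable c (.of_forall fun z => by
      rw [Real.norm_of_nonneg (h₀0 z)]; exact h₀c z)
  let u : ι → Z → ℝ := fun j z => h j z - h₀ z
  have hum : ∀ j, Measurable (u j) := fun j => (hm j).sub hm₀
  have hui : ∀ j, Integrable (u j) Q := fun j => (hi j).sub hi₀
  have hu1 : ∀ j z, u j z ≤ c := fun j z => by
    simp only [u]; linarith [hc j z, h₀0 z]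
  have hu2 : ∀ j z, -c ≤ u j z := fun j z => by
    simp only [u]; linarith [h0 j z, h₀c z]
  have hIu : ∀ j, ∫ z, u j z ∂Q = ∫ z, h j z ∂Q - ∫ z, h₀ z ∂Q := fun j =>
    integral_sub (hi j) hi₀
  have hIu1 : ∀ j, |∫ z, u j z ∂Q| ≤ c := fun j => by
    have := norm_integral_le_of_norm_le_const (μ := Q) (f := u j) (C := c)
      (.of_forall fun z => abs_le.2 ⟨hu2 j z, hu1 j z⟩)
    simpa using this
  let g : (Fin N → Z) → ℝ := fun S => ⨆ j, (0 + ∑ i, (∫ z, u j z ∂Q - u j (S i)))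
  have hgm : Measurable g := Measurable.iSup fun j => by
    have := hum j
    fun_prop
  have hle : ∀ S j, 0 + ∑ i, (∫ z, u j z ∂Q - u j (S i)) ≤ g S := fun S j =>
    le_ciSup_of_finite (fun j => 0 + ∑ i, (∫ z, u j z ∂Q - u j (S i))) j
  have hterm : ∀ (S : Fin N → Z) j, |0 + ∑ i, (∫ z, u j z ∂Q - u j (S i))| ≤ N * (2 * c) := fun S j => by
    rw [zero_add]
    refine (Finset.abs_sum_le_sum_abs _ _).trans
      ((Finset.sum_le_card_nsmul _ _ (2 * c) fun i _ => ?_).trans_eq (by simp))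
    have := abs_le.1 (hIu1 j)
    exact abs_le.2 ⟨by linarith [hu1 j (S i)], by linarith [hu2 j (S i)]⟩
  have hgK : ∀ S, |g S| ≤ N * (2 * c) := fun S => by
    let j := Classical.arbitrary ι
    exact abs_le.2 ⟨(abs_le.1 (hterm S j)).1.trans (hle S j),
      ciSup_le fun j => (abs_le.1 (hterm S j)).2⟩
  have hgc : ∀ (i : Fin N) (S S' : Fin N → Z), (∀ k ≠ i, S k = S' k) → g S - g S' ≤ 2 * c := by
    intro i S S' hS
    rw [sub_le_iff_le_add]
    refine ciSup_le fun j => ?_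
    refine le_trans ?_ (add_le_add_right (hle S' j) _)
    rw [← Finset.add_sum_erase _ _ (Finset.mem_univ i),
      ← Finset.add_sum_erase _ (fun k => ∫ z, u j z ∂Q - u j (S' k)) (Finset.mem_univ i)]
    have : ∑ k ∈ Finset.univ.erase i, (∫ z, u j z ∂Q - u j (S k)) =
        ∑ k ∈ Finset.univ.erase i, (∫ z, u j z ∂Q - u j (S' k)) :=
      Finset.sum_congr rfl fun k hk => by rw [hS k (Finset.ne_of_mem_erase hk)]
    rw [this]
    linarith [hu1 j (S' i), hu2 j (S i)]
  have hEg : ∫ S, g S ∂(Measure.pi fun _ : Fin N => Q) ≤ 2 * R := by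
    have hs := integral_iSup_symmetrization (Q := Q) (n := N) (fun _ : ι => (0 : ℝ)) hui
    have hint : ∀ ε : Fin N → Bool, Integrable
        (fun S : Fin N → Z => ⨆ j, (0 + ∑ i, boolSign (ε i) * (2 * u j (S i))))
        (Measure.pi fun _ => Q) := fun ε =>
      integrable_iSup_of_finite fun j => (integrable_const _).add <|
        integrable_finsetSum _ fun i _ => ((((measurePreserving_eval (fun _ => Q) i)
          |>.integrable_comp_of_integrable (hui j)).const_mul _).const_mul _)
    rw [← integral_finsetSum _ fun ε _ => hint ε] at hs
    have hb : ∫ S, ∑ ε : Fin N → Bool, (⨆ j, (0 + ∑ i, boolSign (ε i) * (2 * u j (S i))))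
        ∂(Measure.pi fun _ : Fin N => Q) ≤ ∫ _, 2 ^ N * (2 * R) ∂(Measure.pi fun _ : Fin N => Q) := by
      refine integral_mono (integrable_finsetSum _ fun ε _ => hint ε) (integrable_const _)
        fun S => ?_
      have e : ∀ ε : Fin N → Bool, (⨆ j, (0 + ∑ i, boolSign (ε i) * (2 * u j (S i)))) =
          2 * ⨆ j, ∑ i, boolSign (ε i) * (h j (S i) - h₀ (S i)) := fun ε => by
        rw [Real.mul_iSup_of_nonneg zero_le_two]
        simp only [u, zero_add, Finset.mul_sum, mul_left_comm]
      simp only [e]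
      rw [← Finset.mul_sum]
      have := (sum_iSup_sign_sub_le (fun j i => h j (S i)) fun i => h₀ (S i)).trans (hR S)
      linarith
    rw [integral_const, probReal_univ, one_smul] at hb
    exact le_of_mul_le_mul_left (hs.trans hb) (by positivity)
  -- Chosen so that the tail `exp (-2 s² / (N (2c)²))` equals `δ`; the oscillation is `2c` because
  -- `u j` ranges in `[-c, c]`.
  set s := c * √(2 * N * Real.log (1 / δ)) with hs
  have hlog : 0 ≤ Real.log (1 / δ) := Real.log_nonneg (by rw [le_div_iff₀ hδ₀]; linarith)
  have hN' : (0 : ℝ) < N := by exact_mod_cast hN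
  have hmc := measureReal_pi_ge_le (Q := Q) hN hgm hgK (by positivity : 0 < 2 * c) hgc
    (by positivity : 0 ≤ s)
  have hexp : Real.exp (-2 * s ^ 2 / (N * (2 * c) ^ 2)) = δ := by
    have : -2 * s ^ 2 / (N * (2 * c) ^ 2) = Real.log δ := by
      rw [hs, mul_pow, Real.sq_sqrt (by positivity), one_div, Real.log_inv]
      field_simp
    rw [this, Real.exp_log hδ₀]
  rw [hexp] at hmc
  have hmeas : MeasurableSet {S | ∫ S', g S' ∂(Measure.pi fun _ : Fin N => Q) + s ≤ g S} :=
    measurableSet_le measurable_const hgm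
  have hcompl := probReal_compl_eq_one_sub (μ := Measure.pi fun _ : Fin N => Q) hmeas
  refine le_trans ?_ (measureReal_mono (s₁ :=
    {S | ∫ S', g S' ∂(Measure.pi fun _ : Fin N => Q) + s ≤ g S}ᶜ) fun S hS j => ?_)
  · rw [hcompl]
    linarith
  · have hS' : g S < ∫ S', g S' ∂(Measure.pi fun _ : Fin N => Q) + s := not_le.1 hS
    have := hle S j
    rw [zero_add, hIu] at this
    linarith

/-- The uniform deviation bound for a countable class of losses. -/
lemma le_measureReal_deviation_of_nat {N : ℕ} (hN : 0 < N)
    {h : ℕ → Z → ℝ} (hm : ∀ j, Measurable (h j)) {h₀ : Z → ℝ} (hm₀ : Measurable h₀) {c : ℝ}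
    (h0 : ∀ j z, 0 ≤ h j z) (hc : ∀ j z, h j z ≤ c) (h₀0 : ∀ z, 0 ≤ h₀ z) (h₀c : ∀ z, h₀ z ≤ c)
    {R : ℝ} (hR : ∀ (k : ℕ) (S : Fin N → Z),
      ∑ ε : Fin N → Bool, ⨆ j : Fin (k + 1), ∑ i, boolSign (ε i) * h j (S i) ≤ 2 ^ N * R)
    {δ : ℝ} (hδ₀ : 0 < δ) (hδ₁ : δ < 1) :
    1 - δ ≤ (Measure.pi fun _ : Fin N => Q).real {S | ∀ j,
      ∑ i, ((∫ z, h j z ∂Q - ∫ z, h₀ z ∂Q) - (h j (S i) - h₀ (S i))) ≤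
        2 * R + c * √(2 * N * Real.log (1 / δ))} := by
  let A : ℕ → Set (Fin N → Z) := fun k => {S | ∀ j : Fin (k + 1),
      ∑ i, ((∫ z, h j z ∂Q - ∫ z, h₀ z ∂Q) - (h j (S i) - h₀ (S i))) ≤
        2 * R + c * √(2 * N * Real.log (1 / δ))}
  have hA : ∀ k, MeasurableSet (A k) := fun k => by
    simp only [A, Set.ofPred_forall]
    refine MeasurableSet.iInter fun j => measurableSet_le ?_ measurable_const
    have := hm j
    fun_prop
  have hanti : Antitone A := fun k l hkl S hS j => hS ⟨j, by omega⟩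
  have hset : {S : Fin N → Z | ∀ j,
      ∑ i, ((∫ z, h j z ∂Q - ∫ z, h₀ z ∂Q) - (h j (S i) - h₀ (S i))) ≤
        2 * R + c * √(2 * N * Real.log (1 / δ))} = ⋂ k, A k := by
    ext S
    simp only [Set.mem_iInter]
    exact ⟨fun hS k j => hS j, fun hS j => hS j ⟨j, j.lt_succ_self⟩⟩
  rw [hset]
  -- Continuity from above: the events for the finite segments decrease, each with probability at
  -- least `1 - δ`.
  have ht := tendsto_measure_iInter_atTop (μ := Measure.pi fun _ : Fin N => Q)
    (fun k => (hA k).nullMeasurableSet) hanti ⟨0, measure_ne_top _ _⟩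
  have ht' := (ENNReal.tendsto_toReal (measure_ne_top _ _)).comp ht
  exact ge_of_tendsto' ht' fun k =>
    le_measureReal_deviation_of_finite (Q := Q) hN (fun j : Fin (k + 1) => hm j) hm₀
      (fun j => h0 j) (fun j => hc j) h₀0 h₀c (hR k) hδ₀ hδ₁

end Deviation

/-! ### Bounds for diverse networks and the squared loss; passage to the full class. -/

section Network

open MeasureTheory

lemma feature_le {D M : ℕ} {ρ : ℝ → ℝ} {L : ℝ≥0} (hρ : LipschitzWith L ρ)
    {W : Fin M → EuclideanSpace ℝ (Fin D)} {x : EuclideanSpace ℝ (Fin D)} {C₁ C₃ : ℝ}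
    (hx : ‖x‖ ≤ C₁) {m : Fin M} (hW : ‖W m‖ ≤ C₃) : feature ρ W m x ≤ constC5 ρ L C₁ C₃ := by
  have h := hρ.dist_le_mul (inner ℝ (W m) x) 0
  rw [Real.dist_eq, Real.dist_eq, sub_zero] at h
  have h2 : |inner ℝ (W m) x| ≤ C₃ * C₁ := (abs_real_inner_le_norm _ _).trans
    (mul_le_mul hW hx (norm_nonneg _) ((norm_nonneg _).trans hW))
  have h3 := mul_le_mul_of_nonneg_left h2 L.coe_nonneg
  have h4 := le_abs_self (ρ (inner ℝ (W m) x) - ρ 0)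
  simp only [feature, constC5]
  linarith

/-- The diagonal contributes zero, so the square can be expanded over all pairs. This converts a
lower bound on diversity into an upper bound on `(∑ a m)²`. -/
lemma sum_offDiag_sub_sq {M : ℕ} (a : Fin M → ℝ) :
    ∑ p ∈ (Finset.univ : Finset (Fin M)).offDiag, (a p.1 - a p.2) ^ 2 =
      2 * M * ∑ m, a m ^ 2 - 2 * (∑ m, a m) ^ 2 := by
  have h1 : ∑ p ∈ (Finset.univ : Finset (Fin M)).offDiag, (a p.1 - a p.2) ^ 2 =
      ∑ p : Fin M × Fin M, (a p.1 - a p.2) ^ 2 := by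
    refine Finset.sum_subset (Finset.subset_univ _) fun p _ hp => ?_
    have : p.1 = p.2 := by simpa using hp
    simp [this]
  rw [h1, Fintype.sum_prod_type, sq (∑ m, a m), Finset.sum_mul_sum]
  simp only [sub_sq, Finset.sum_add_distrib, Finset.sum_sub_distrib, Finset.sum_const,
    Finset.card_univ, Fintype.card_fin, nsmul_eq_mul, Finset.mul_sum]
  simp only [← Finset.mul_sum, mul_assoc]
  ring

/-- A diversity lower bound improves the bound on the output of a network. -/
lemma abs_network_le {D M : ℕ} (hM : 2 ≤ M) {ρ : ℝ → ℝ} (hρ : ∀ t, 0 ≤ ρ t)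
    {W : Fin M → EuclideanSpace ℝ (Fin D)} {v : Fin M → ℝ} {x : EuclideanSpace ℝ (Fin D)}
    {C₄ C₅ d : ℝ} (hφ : ∀ m, feature ρ W m x ≤ C₅) (hv : ‖v‖ ≤ C₄)
    (hd : d ^ 2 ≤ diversity ρ W x) : |network ρ W v x| ≤ √(constJ M C₄ C₅ d) := by
  have hC₄ : 0 ≤ C₄ := (norm_nonneg v).trans hv
  have hM' : (2 : ℝ) ≤ M := by exact_mod_cast hM
  have hφ0 : ∀ m, 0 ≤ feature ρ W m x := fun m => hρ _
  have habs : |network ρ W v x| ≤ C₄ * ∑ m, feature ρ W m x := by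
    rw [network, Finset.mul_sum]
    refine (Finset.abs_sum_le_sum_abs _ _).trans (Finset.sum_le_sum fun m _ => ?_)
    rw [abs_mul, abs_of_nonneg (hφ0 m)]
    exact mul_le_mul_of_nonneg_right ((norm_le_pi_norm v m).trans hv) (hφ0 m)
  refine Real.le_sqrt_of_sq_le ?_
  refine (pow_le_pow_left₀ (abs_nonneg _) habs 2).trans ?_
  rw [mul_pow, constJ]
  refine mul_le_mul_of_nonneg_left ?_ (sq_nonneg _)
  rw [diversity, sum_offDiag_sub_sq (fun m => feature ρ W m x), one_div, ← div_eq_inv_mul, le_div_iff₀ (by nlinarith)] at hd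
  have hsq : ∑ m, feature ρ W m x ^ 2 ≤ M * C₅ ^ 2 :=
    (Finset.sum_le_card_nsmul _ _ (C₅ ^ 2) fun m _ =>
      pow_le_pow_left₀ (hφ0 m) (hφ m) 2).trans_eq (by simp)
  have := mul_le_mul_of_nonneg_left hsq (by linarith : (0 : ℝ) ≤ M)
  linarith

lemma sqLoss_nonneg (t y : ℝ) : 0 ≤ sqLoss t y := by
  unfold sqLoss
  positivity

lemma sqLoss_le {t y a b : ℝ} (ht : |t| ≤ a) (hy : |y| ≤ b) :
    sqLoss t y ≤ 1 / 2 * (a + b) ^ 2 := by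
  unfold sqLoss
  gcongr
  exact (abs_sub _ _).trans (add_le_add ht hy)

/-- A difference of squares factors through the mean of the residuals `s - y` and `t - y`. This is
the Lipschitz constant used for contraction. -/
lemma abs_sqLoss_sub_le {s t y a b : ℝ} (hs : |s| ≤ a) (ht : |t| ≤ a) (hy : |y| ≤ b) :
    |sqLoss s y - sqLoss t y| ≤ (a + b) * |s - t| := by
  have e : sqLoss s y - sqLoss t y = ((s - y) + (t - y)) / 2 * (s - t) := by
    simp only [sqLoss, sq_abs]
    ring
  rw [e, abs_mul]
  refine mul_le_mul_of_nonneg_right ?_ (abs_nonneg _)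
  rw [abs_le] at *
  constructor <;> linarith [hs.1, hs.2, ht.1, ht.2, hy.1, hy.2]

lemma continuous_sqLoss : Continuous fun p : ℝ × ℝ => sqLoss p.1 p.2 := by
  unfold sqLoss
  fun_prop

lemma continuous_network {D M : ℕ} {ρ : ℝ → ℝ} (hρ : Continuous ρ) :
    Continuous fun q : ((Fin M → EuclideanSpace ℝ (Fin D)) × (Fin M → ℝ)) ×
      EuclideanSpace ℝ (Fin D) => network ρ q.1.1 q.1.2 q.2 := by
  unfold network feature
  fun_prop

/-- The parameters of the networks in `hypothesisClass`. -/
def paramSet {D : ℕ} (M : ℕ) (ρ : ℝ → ℝ) (X : Set (EuclideanSpace ℝ (Fin D)))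
    (C₃ C₄ dmin : ℝ) : Set ((Fin M → EuclideanSpace ℝ (Fin D)) × (Fin M → ℝ)) :=
  {p | (∀ m, ‖p.1 m‖ ≤ C₃) ∧ ‖p.2‖ ≤ C₄ ∧ ∀ x ∈ X, dmin ^ 2 ≤ diversity ρ p.1 x}

lemma exists_mem_paramSet_of_mem {D M : ℕ} {ρ : ℝ → ℝ} {X : Set (EuclideanSpace ℝ (Fin D))}
    {C₃ C₄ dmin : ℝ} {f : EuclideanSpace ℝ (Fin D) → ℝ}
    (hf : f ∈ hypothesisClass M ρ X C₃ C₄ dmin) :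
    ∃ p : paramSet M ρ X C₃ C₄ dmin, f = network ρ p.1.1 p.1.2 := by
  obtain ⟨W, v, h1, h2, h3, h4⟩ := hf
  exact ⟨⟨(W, v), h1, h2, h3⟩, h4⟩

/-- The generalization bound in unnormalized form. -/
lemma exists_measurableSet_card_mul_risk_sub_le {D M N : ℕ} (hM : 2 ≤ M) (hN : 0 < N)
    {ρ : ℝ → ℝ} {L : ℝ≥0} (hρ0 : ∀ t, 0 ≤ ρ t) (hρ : LipschitzWith L ρ)
    {C₁ C₂ C₃ C₄ dmin : ℝ} {X : Set (EuclideanSpace ℝ (Fin D))} (hX : ∀ x ∈ X, ‖x‖ ≤ C₁)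
    {Q : Measure (EuclideanSpace ℝ (Fin D) × ℝ)} [IsProbabilityMeasure Q]
    (hQ : ∀ᵐ z ∂Q, z.1 ∈ X ∧ |z.2| ≤ C₂) {f₀ : EuclideanSpace ℝ (Fin D) → ℝ}
    (hf₀ : f₀ ∈ hypothesisClass M ρ X C₃ C₄ dmin) {B : ℝ}
    (hB : B = √(constJ M C₄ (constC5 ρ L C₁ C₃) dmin) + C₂)
    {δ : ℝ} (hδ₀ : 0 < δ) (hδ₁ : δ < 1) :
    0 ≤ B ∧ 0 ≤ constA M ρ L C₁ C₃ C₄ ∧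
    ∃ E : Set (Fin N → EuclideanSpace ℝ (Fin D) × ℝ), MeasurableSet E ∧
      1 - δ ≤ (Measure.pi (fun _ : Fin N => Q)).real E ∧
      ∀ S ∈ E, ∀ f ∈ hypothesisClass M ρ X C₃ C₄ dmin,
        N * ((risk Q f - risk Q f₀) - (empRisk S f - empRisk S f₀)) ≤
          B * constA M ρ L C₁ C₃ C₄ / 2 * √N +
            1 / 2 * B ^ 2 * √(2 * N * Real.log (1 / δ)) := by
  obtain ⟨G, hGmem, hG, hGX⟩ := hQ.exists_measurable_mem
  obtain ⟨z₀, hz₀⟩ : G.Nonempty := by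
    rw [Set.nonempty_iff_ne_empty]
    rintro rfl
    exact (ae_neBot.2 (IsProbabilityMeasure.ne_zero Q)).ne (Filter.empty_mem_iff_bot.1 hGmem)
  obtain ⟨p₀, rfl⟩ := exists_mem_paramSet_of_mem hf₀
  have hC₁ : 0 ≤ C₁ := (norm_nonneg _).trans (hX _ (hGX z₀ hz₀).1)
  have hC₂ : 0 ≤ C₂ := (abs_nonneg _).trans (hGX z₀ hz₀).2
  have hC₃ : 0 ≤ C₃ := (norm_nonneg _).trans (p₀.2.1 ⟨0, by omega⟩)
  have hC₄ : 0 ≤ C₄ := (norm_nonneg _).trans p₀.2.2.1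
  have hB0 : 0 ≤ B := by rw [hB]; positivity
  refine ⟨hB0, by unfold constA; positivity, ?_⟩
  have hρc : Continuous ρ := hρ.continuous
  have hnc := continuous_network (D := D) (M := M) hρc
  classical
  -- Retraction onto the full-measure set `G`: the bounds on the composed losses hold everywhere,
  -- while risks are unchanged.
  let π : EuclideanSpace ℝ (Fin D) × ℝ → EuclideanSpace ℝ (Fin D) × ℝ :=
    fun z => if z ∈ G then z else z₀
  have hπm : Measurable π := Measurable.ite hG measurable_id measurable_const
  have hπG : ∀ z, π z ∈ G := fun z => by
    simp only [π]
    split_ifs with h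
    exacts [h, hz₀]
  have hπe : ∀ z ∈ G, π z = z := fun z hz => if_pos hz
  have hnet : ∀ (p : paramSet M ρ X C₃ C₄ dmin) (z), z ∈ G → |network ρ p.1.1 p.1.2 z.1| ≤
      √(constJ M C₄ (constC5 ρ L C₁ C₃) dmin) := fun p z hz =>
    abs_network_le hM hρ0 (fun m => feature_le hρ (hX _ (hGX z hz).1) (p.2.1 m)) p.2.2.1
      (p.2.2.2 _ (hGX z hz).1)
  let h : paramSet M ρ X C₃ C₄ dmin → EuclideanSpace ℝ (Fin D) × ℝ → ℝ :=
    fun p z => sqLoss (network ρ p.1.1 p.1.2 (π z).1) (π z).2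
  have hm : ∀ p, Measurable (h p) := fun p => by
    have : Continuous fun z : EuclideanSpace ℝ (Fin D) × ℝ =>
        sqLoss (network ρ p.1.1 p.1.2 z.1) z.2 :=
      continuous_sqLoss.comp ((hnc.comp (continuous_const.prodMk continuous_fst)).prodMk
        continuous_snd)
    exact this.measurable.comp hπm
  have h0 : ∀ p z, 0 ≤ h p z := fun p z => sqLoss_nonneg _ _
  have hc : ∀ p z, h p z ≤ 1 / 2 * B ^ 2 := fun p z => by
    rw [hB]
    exact sqLoss_le (hnet p _ (hπG z)) (hGX _ (hπG z)).2
  have hhc : ∀ z, Continuous fun p => h p z := fun z =>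
    continuous_sqLoss.comp ((hnc.comp (continuous_subtype_val.prodMk continuous_const)).prodMk
      continuous_const)
  have hrisk : ∀ p, ∫ z, h p z ∂Q = risk Q (network ρ p.1.1 p.1.2) := fun p =>
    integral_congr_ae (by filter_upwards [hGmem] with z hz; simp only [h, hπe z hz])
  have hIc : Continuous fun p => ∫ z, h p z ∂Q :=
    continuous_of_dominated (fun p => (hm p).aestronglyMeasurable)
      (fun p => .of_forall fun z => by rw [Real.norm_of_nonneg (h0 p z)]; exact hc p z)
      (integrable_const _) (.of_forall hhc)
  have : Nonempty (paramSet M ρ X C₃ C₄ dmin) := ⟨p₀⟩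
  let d := TopologicalSpace.denseSeq (paramSet M ρ X C₃ C₄ dmin)
  have hd : DenseRange d := TopologicalSpace.denseRange_denseSeq _
  have hR : ∀ (k : ℕ) (S : Fin N → EuclideanSpace ℝ (Fin D) × ℝ),
      ∑ ε : Fin N → Bool, ⨆ j : Fin (k + 1), ∑ i, boolSign (ε i) * h (d j) (S i) ≤
        2 ^ N * (B * constA M ρ L C₁ C₃ C₄ / 4 * √N) := by
    intro k S
    have h1 := sum_iSup_sign_contraction (fun _ => 0)
      (fun (j : Fin (k + 1)) i => h (d j) (S i))
      (fun j i => B * network ρ (d j).1.1 (d j).1.2 (π (S i)).1) (fun j l i => by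
        rw [← mul_sub, abs_mul, abs_of_nonneg hB0, hB]
        exact abs_sqLoss_sub_le (hnet _ _ (hπG _)) (hnet _ _ (hπG _)) (hGX _ (hπG _)).2)
    simp only [zero_add] at h1
    have h2 := sum_iSup_sign_network_le hρ (fun j : Fin (k + 1) => (d j).1.1)
      (fun j => (d j).1.2) (fun i => (π (S i)).1) hC₁ (fun i => hX _ (hGX _ (hπG _)).1) hC₃
      (fun j m => (d j).2.1 m) hC₄ (fun j m => (norm_le_pi_norm _ m).trans (d j).2.2.1)
    have e : ∀ ε : Fin N → Bool, (⨆ j : Fin (k + 1), ∑ i, boolSign (ε i) *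
        (B * network ρ (d j).1.1 (d j).1.2 (π (S i)).1)) = B * ⨆ j : Fin (k + 1),
          ∑ i, boolSign (ε i) * network ρ (d j).1.1 (d j).1.2 (π (S i)).1 := fun ε => by
      rw [Real.mul_iSup_of_nonneg hB0]
      simp only [Finset.mul_sum, mul_left_comm]
    simp only [e] at h1
    rw [← Finset.mul_sum] at h1
    refine h1.trans ((mul_le_mul_of_nonneg_left h2 hB0).trans_eq ?_)
    unfold constA
    ring
  have hdev := le_measureReal_deviation_of_nat (Q := Q) hN (fun j => hm (d j)) (hm p₀)
    (fun j => h0 (d j)) (fun j => hc (d j)) (h0 p₀) (hc p₀) hR hδ₀ hδ₁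
  set T := {S : Fin N → EuclideanSpace ℝ (Fin D) × ℝ | ∀ j,
      ∑ i, ((∫ z, h (d j) z ∂Q - ∫ z, h p₀ z ∂Q) - (h (d j) (S i) - h p₀ (S i))) ≤
        2 * (B * constA M ρ L C₁ C₃ C₄ / 4 * √N) +
          1 / 2 * B ^ 2 * √(2 * N * Real.log (1 / δ))} with hT
  have hTm : MeasurableSet T := by
    simp only [hT, Set.ofPred_forall]
    refine MeasurableSet.iInter fun j => measurableSet_le ?_ measurable_const
    have h1 := hm (d j)
    have h2 := hm p₀
    fun_prop
  have hGN : ∀ᵐ S ∂(Measure.pi fun _ : Fin N => Q), ∀ i, S i ∈ G :=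
    Filter.eventually_all.2 fun i => Measure.tendsto_eval_ae_ae.eventually hGmem
  -- Requiring all sample points to lie in `G` costs no probability and makes the empirical risks of
  -- the modified losses the true ones.
  refine ⟨T ∩ Set.univ.pi fun _ => G, hTm.inter (MeasurableSet.univ_pi fun _ => hG), ?_, ?_⟩
  · refine hdev.trans_eq (measureReal_congr ?_)
    refine (inter_ae_eq_left_of_ae_eq_univ (Filter.eventuallyEq_univ.2 ?_)).symm
    filter_upwards [hGN] with S hS using fun i _ => hS i
  · rintro S ⟨hST, hSG⟩ f hf
    obtain ⟨p, rfl⟩ := exists_mem_paramSet_of_mem hf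
    have hcl : IsClosed {p | ∑ i, ((∫ z, h p z ∂Q - ∫ z, h p₀ z ∂Q) -
        (h p (S i) - h p₀ (S i))) ≤ 2 * (B * constA M ρ L C₁ C₃ C₄ / 4 * √N) +
          1 / 2 * B ^ 2 * √(2 * N * Real.log (1 / δ))} :=
      isClosed_le (continuous_finsetSum _ fun i _ => (hIc.sub continuous_const).sub
        ((hhc (S i)).sub continuous_const)) continuous_const
    -- For a fixed sample the inequality is closed in the parameter, so it extends from the dense
    -- sequence.
    have hp := hd.induction_on (p := fun p => ∑ i, ((∫ z, h p z ∂Q - ∫ z, h p₀ z ∂Q) -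
        (h p (S i) - h p₀ (S i))) ≤ 2 * (B * constA M ρ L C₁ C₃ C₄ / 4 * √N) +
          1 / 2 * B ^ 2 * √(2 * N * Real.log (1 / δ))) p hcl hST
    have hemp : ∀ p, ∑ i, h p (S i) = N * empRisk S (network ρ p.1.1 p.1.2) := fun p => by
      have hN' : (N : ℝ) ≠ 0 := by exact_mod_cast hN.ne'
      rw [empRisk, ← mul_assoc, mul_one_div_cancel hN', one_mul]
      exact Finset.sum_congr rfl fun i _ => by
        simp only [h, hπe _ (hSG i (Set.mem_univ i))]
    simp only [Finset.sum_sub_distrib, hemp, hrisk, Finset.sum_const, Finset.card_univ,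
      Fintype.card_fin, nsmul_eq_mul] at hp
    linarith

lemma strictAntiOn_constJ {M : ℕ} (hM : 2 ≤ M) {C₄ : ℝ} (hC₄ : C₄ ≠ 0) (C₅ : ℝ) :
    StrictAntiOn (fun d => constJ M C₄ C₅ d) (Set.Ici 0) := by
  intro a ha b _ hab
  have hM' : (2 : ℝ) ≤ M := by exact_mod_cast hM
  have h1 : a ^ 2 < b ^ 2 := pow_lt_pow_left₀ hab ha two_ne_zero
  have h2 : 0 < (M : ℝ) * (M - 1) := by nlinarith
  have h3 : 0 < C₄ ^ 2 := by positivity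
  simp only [constJ]
  gcongr

lemma antitoneOn_constJ {M : ℕ} (hM : 2 ≤ M) (C₄ C₅ : ℝ) :
    AntitoneOn (fun d => constJ M C₄ C₅ d) (Set.Ici 0) := by
  by_cases hC₄ : C₄ = 0
  · intro a _ b _ _
    simp [constJ, hC₄]
  · exact (strictAntiOn_constJ hM hC₄ C₅).antitoneOn

end Network

end DiverseNet

/-! ### Excess risk of empirical minimizers. -/

theorem mainTheorem1 (D M N : ℕ) (hM : 2 ≤ M) (hN : 0 < N)
    (ρ : ℝ → ℝ) (L : ℝ≥0) (hρ_nonneg : ∀ t, 0 ≤ ρ t) (hρ_lip : LipschitzWith L ρ)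
    (C₁ C₂ C₃ C₄ dmin : ℝ)
    (X : Set (EuclideanSpace ℝ (Fin D))) (hX : ∀ x ∈ X, ‖x‖ ≤ C₁)
    (Q : MeasureTheory.Measure (EuclideanSpace ℝ (Fin D) × ℝ))
    [MeasureTheory.IsProbabilityMeasure Q]
    (hQ : ∀ᵐ z ∂Q, z.1 ∈ X ∧ |z.2| ≤ C₂)
    (fstar : EuclideanSpace ℝ (Fin D) → ℝ)
    (hfstar : DiverseNet.IsArgmin (DiverseNet.risk Q)
      (DiverseNet.hypothesisClass M ρ X C₃ C₄ dmin) fstar)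
    (δ : ℝ) (hδ₀ : 0 < δ) (hδ₁ : δ < 1) :
    (∃ E : Set (Fin N → EuclideanSpace ℝ (Fin D) × ℝ), MeasurableSet E ∧
      1 - δ ≤ (MeasureTheory.Measure.pi (fun _ : Fin N => Q)).real E ∧
      ∀ S ∈ E, ∀ fhat : EuclideanSpace ℝ (Fin D) → ℝ,
        DiverseNet.IsArgmin (DiverseNet.empRisk S)
          (DiverseNet.hypothesisClass M ρ X C₃ C₄ dmin) fhat →
        DiverseNet.risk Q fhat - DiverseNet.risk Q fstar ≤
          (√(DiverseNet.constJ M C₄ (DiverseNet.constC5 ρ L C₁ C₃) dmin) + C₂) *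
              (DiverseNet.constA M ρ L C₁ C₃ C₄ / √(N : ℝ)) +
            1 / 2 * (√(DiverseNet.constJ M C₄ (DiverseNet.constC5 ρ L C₁ C₃) dmin) + C₂) ^ 2 *
              √(2 * Real.log (2 / δ) / (N : ℝ))) ∧
    AntitoneOn (fun d : ℝ => DiverseNet.constJ M C₄ (DiverseNet.constC5 ρ L C₁ C₃) d)
      (Set.Ici 0) ∧
    (C₄ ≠ 0 →
      StrictAntiOn (fun d : ℝ => DiverseNet.constJ M C₄ (DiverseNet.constC5 ρ L C₁ C₃) d)
        (Set.Ici 0)) := by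
  refine ⟨?_, DiverseNet.antitoneOn_constJ hM _ _, fun hC => DiverseNet.strictAntiOn_constJ hM hC _⟩
  obtain ⟨hB, hA, E, hE, hEp, hEb⟩ := DiverseNet.exists_measurableSet_card_mul_risk_sub_le
    hM hN hρ_nonneg hρ_lip hX hQ hfstar.1 rfl hδ₀ hδ₁
  refine ⟨E, hE, hEp, fun S hS fhat hfhat => ?_⟩
  have hb := hEb S hS fhat hfhat.1
  have hemp := hfhat.2 fstar hfstar.1
  set B := √(DiverseNet.constJ M C₄ (DiverseNet.constC5 ρ L C₁ C₃) dmin) + C₂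
  set A := DiverseNet.constA M ρ L C₁ C₃ C₄
  have hN' : (0 : ℝ) < N := by exact_mod_cast hN
  -- The one-sided argument needs no union bound and yields `log (1 / δ)`, which is stronger than
  -- required.
  have hlog : Real.log (1 / δ) ≤ Real.log (2 / δ) :=
    Real.log_le_log (by positivity) (by gcongr; norm_num)
  have hsq : √(2 * N * Real.log (1 / δ)) ≤ N * √(2 * Real.log (2 / δ) / N) := by
    refine Real.sqrt_le_iff.2 ⟨by positivity, ?_⟩
    have hlog0 : 0 ≤ Real.log (2 / δ) :=
      (Real.log_nonneg (by rw [le_div_iff₀ hδ₀]; linarith)).trans hlog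
    rw [mul_pow, Real.sq_sqrt (by positivity)]
    refine (mul_le_mul_of_nonneg_left hlog (by positivity)).trans_eq ?_
    field_simp
  -- Here too a factor 2 is given away: the deviation bound only costs `A / 2`.
  have hA' : B * A / 2 * √N ≤ N * (B * (A / √N)) := by
    have e : (N : ℝ) * (B * (A / √N)) = B * A * √N := by
      field_simp
      rw [Real.sq_sqrt hN'.le]
      ring
    rw [e]
    have := mul_nonneg (mul_nonneg hB hA) (Real.sqrt_nonneg (N : ℝ))
    linarith
  refine le_of_mul_le_mul_left ?_ hN'
  have h1 := mul_le_mul_of_nonneg_left hsq (by positivity : 0 ≤ 1 / 2 * B ^ 2)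
  have h2 := mul_le_mul_of_nonneg_left hemp hN'.le
  linarith
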